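/- Setting. Let $\mathcal G$ be a connected simple graph on $n\ge 2$ nodes. A gossip matrix on $\mathcal G$ is a symmetric positive semi-definite $W\in\mathbb R^{n\times n}$ whose kernel is the set of constant vectors and such that $W_{ij}\neq 0$ only if $i=j$ or $\{i,j\}$ is an edge of $\mathcal G$. With $\lambda_1(W)\ge\dots\ge\lambda_n(W)=0$ its eigenvalues, its eigengap is $\gamma(W)=\lambda_{n-1}(W)/\lambda_1(W)\in(0,1]$. Node $i$ holds a function $f_i:\ell_2\to\mathbb R$, and $\bar f=\frac1n\sum_{i=1}^n f_i$. For $\tau>0$, a (run of a) black-box procedure using $W$ consists of finite memories $\mathcal M_{i,t}\subset\ell_2$ and outputs $\theta_{i,t}\in\mathcal M_{i,t}$, for every node $i$ and every real time $t\ge0$, such that $\mathcal M_{i,0}=\{0\}$ and, for $t>0$, $\mathcal M_{i,t}\subset\mathcal M^{comp}_{i,t}\cup\mathcal M^{comm}_{i,t}$, where $$\mathcal M^{comp}_{i,t}=\mathrm{Span}\{\theta,\nabla f_i(\theta),\nabla f_i^*(\theta):\theta\in\mathcal M_{i,s},\ 0\le s\le t-1\},$$ $$\mathcal M^{comm}_{i,t}=\mathrm{Span}\Big\{\sum_{j=1}^nW_{ij}x_j:\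 x_j\in\mathcal M_{j,s_j},\ 0\le s_j\le t-\tau\Big\},$$ and $f_i^*$ is the Fenchel conjugate of $f_i$ (computations take time $1$, communications take time $\tau$). Statement. For every $\kappa_0>1$ there is a constant $C>0$, depending only on $\kappa_0$, such that for all $\gamma\in(0,1]$ and all $\alpha,\beta>0$ with $\kappa_l=\beta/\alpha\ge\kappa_0$ there exist $n\ge2$, a connected graph on $n$ nodes, a gossip matrix $W$ on it with $\gamma(W)=\gamma$, and $\alpha$-strongly convex, $\beta$-smooth functions $f_1,\dots,f_n:\ell_2\to\mathbb R$ such that $\bar f$ has a minimizer $\theta^*$ and the following holds. For every $\tau>0$, every black-box procedure using $W$, every $\varepsilon>0$, every node $i$ and every time $t\ge0$ with $\bar f(\theta_{i,t})-\bar f(\theta^*)\le\varepsilon$, $$t\ \ge\ C\,\sqrt{\kappa_l}\,\Big(1+\frac{\tau}{\sqrt\gamma}\Big)\ln\Big(\frac1\varepsilon\Big).$$ -/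

import Mathlib

open scoped BigOperators Gradient

noncomputable section

/-- `W` is a gossip matrix for the network `G`: symmetric, positive semi-definite, its kernel is the
set of constant vectors, and it is supported on the diagonal and the edges of `G`. -/
structure IsGossipMatrix {n : ℕ} (G : SimpleGraph (Fin n)) (W : Matrix (Fin n) (Fin n) ℝ) :
    Prop where
  isSymm : W.IsSymm
  posSemidef : W.PosSemidef
  ker_eq : ∀ x : Fin n → ℝ, W.mulVec x = 0 ↔ ∃ c : ℝ, x = fun _ => c
  support : ∀ i j, W i j ≠ 0 → i = j ∨ G.Adj i j

/-- The normalized eigengap `λ_{n-1}(W) / λ_1(W)` of a symmetric real matrix of size `n ≥ 2`, where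
`λ_1(W) ≥ ⋯ ≥ λ_n(W)` are the eigenvalues with multiplicity (`eigenvalues₀` lists them in
decreasing order, with indices starting at `0`). -/
def eigengap {n : ℕ} (hn : 2 ≤ n) {W : Matrix (Fin n) (Fin n) ℝ} (hW : W.IsHermitian) : ℝ :=
  hW.eigenvalues₀ ⟨n - 2, by rw [Fintype.card_fin]; omega⟩ /
    hW.eigenvalues₀ ⟨0, by rw [Fintype.card_fin]; omega⟩

section Functions

variable {E : Type*} [NormedAddCommGroup E] [InnerProductSpace ℝ E] [CompleteSpace E]

/-- `f` is `β`-smooth: differentiable with a `β`-Lipschitz gradient. -/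
def IsSmoothFun (β : ℝ) (f : E → ℝ) : Prop :=
  Differentiable ℝ f ∧ ∀ x y, ‖∇ f x - ∇ f y‖ ≤ β * ‖x - y‖

/-- The Fenchel conjugate `f*(y) = sup_x ⟨x, y⟩ - f(x)`. The supremum is finite whenever `f` is
differentiable and strongly convex, the only case in which it is used. -/
def fenchelConjugate (f : E → ℝ) (y : E) : ℝ :=
  ⨆ x, (inner ℝ x y - f x)

/-- The global objective `θ ↦ (1/n) ∑ i, f i θ`. -/
def averageFun {n : ℕ} (f : Fin n → E → ℝ) (θ : E) : ℝ :=
  (1 / (n : ℝ)) * ∑ i, f i θ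

/-- What node `i` can obtain by local computation (duration `1`) at time `t`, given the memories
`M j s` of the nodes `j` at the times `s`: linear combinations of values `θ` that it held at times
`0 ≤ s ≤ t - 1`, of gradients `∇ f_i(θ)` and of gradients `∇ f_i*(θ)` at such values. -/
def compMemory {n : ℕ} (f : Fin n → E → ℝ) (M : Fin n → ℝ → Set E) (i : Fin n) (t : ℝ) :
    Submodule ℝ E :=
  Submodule.span ℝ {v | ∃ s, 0 ≤ s ∧ s ≤ t - 1 ∧ ∃ θ ∈ M i s,
    v = θ ∨ v = ∇ (f i) θ ∨ v = ∇ (fenchelConjugate (f i)) θ}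

/-- What node `i` can obtain by communication (duration `τ`) at time `t` when communication is
multiplication by `W`: linear combinations of vectors `(W x)_i = ∑ j, W i j • x j`, where `x j` is a
value that node `j` held at some time `0 ≤ s j ≤ t - τ`. -/
def commMemory {n : ℕ} (W : Matrix (Fin n) (Fin n) ℝ) (τ : ℝ) (M : Fin n → ℝ → Set E)
    (i : Fin n) (t : ℝ) : Submodule ℝ E :=
  Submodule.span ℝ {v | ∃ (s : Fin n → ℝ) (x : Fin n → E),
    (∀ j, 0 ≤ s j ∧ s j ≤ t - τ ∧ x j ∈ M j (s j)) ∧ v = ∑ j, W i j • x j}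

/-- A run, on the local functions `f`, of a (possibly asynchronous) black-box procedure that uses
the matrix `W`, with unit computation time and communication time `τ`. Time is a real number
`t ≥ 0`; `memory i t` is the finite memory of node `i` at time `t`, and `output i t` its output. -/
structure BlackBoxProcedure {n : ℕ} (W : Matrix (Fin n) (Fin n) ℝ) (τ : ℝ)
    (f : Fin n → E → ℝ) where
  memory : Fin n → ℝ → Set E
  output : Fin n → ℝ → E
  memory_finite : ∀ i t, 0 ≤ t → (memory i t).Finite
  memory_zero : ∀ i, memory i 0 = {0}
  memory_subset : ∀ i t, 0 < t →
    memory i t ⊆ (compMemory f memory i t : Set E) ∪ (commMemory W τ memory i t : Set E)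
  output_mem : ∀ i t, 0 ≤ t → output i t ∈ memory i t

end Functions

end

/-!
The hard instance splits Nesterov's worst quadratic function between two distant groups of nodes.

On `3 m` nodes, each `f_i` is `⟨A_i x, x⟩ / 2 - ⟨b, x⟩`, where `A_i` acts as `α` on the fixed
vectors and as `β` on the negated vectors of an involution of `ℓ²` that permutes coordinates
(`twoEigMap`). The first third of the nodes swaps the coordinates `2 k + 1` and `2 k + 2`, the last
third swaps `2 k` and `2 k + 1`, and the middle third swaps nothing (`nodeSwap`). The inverse of
`A_i` has the same form, so neither `∇ f_i` nor `∇ f_i*` can leave the span of the first `k`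
coordinates unless the involution of node `i` couples the coordinates `k - 1` and `k`
(`gradients_mem_of_stable`). Hence the successive coordinates are revealed alternately by the two
outer groups, and each one costs one computation and enough communications to travel from one group
to the other: about `1 + m τ / 2` units of time (`memory_subset_coordsBelow`).

The minimizer of the average is a geometric sequence `a q ^ j` with `1 - q` of order `1 / √κ`
(`sum_twoEigMap_geomL2_sub`, `exists_ratio`), so by strong convexity a vector supported on `k`
coordinates has an error of at least `α / 2 * (a q ^ k) ^ 2` (`le_averageFun_sub`). As `a` can be
chosen freely, no additive term appears in the resulting bound on time.

It remains to realize every eigengap `γ` by a gossip matrix whose nonzero entries are confined to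
`|i - j| ≤ 2`, on at least `c / √γ` nodes (`exists_isGossipMatrix`). For small `γ` this is a
quadratic polynomial in the Laplacian of the path, for which crude bounds on the extreme nonzero
eigenvalues suffice; for `γ` bounded below three nodes are enough.
-/

noncomputable section

/-! ### Quadratic functions -/

section Quadratic

variable {E : Type*} [NormedAddCommGroup E] [InnerProductSpace ℝ E]

/-- The quadratic function `x ↦ ⟨A x, x⟩ / 2 - ⟨b, x⟩`. -/
def quadFun (A : E →L[ℝ] E) (b x : E) : ℝ :=
  1 / 2 * inner ℝ (A x) x - inner ℝ b x

theorem quadFun_sub {A : E →L[ℝ] E} (hA : ∀ x y, inner ℝ (A x) y = inner ℝ x (A y)) (b x y : E) :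
    quadFun A b y - quadFun A b x
      = inner ℝ (A x - b) (y - x) + 1 / 2 * inner ℝ (A (y - x)) (y - x) := by
  have h : inner ℝ (A y) x = inner ℝ (A x) y := by rw [hA, real_inner_comm]
  simp only [quadFun, map_sub, inner_sub_left, inner_sub_right, h]
  ring

/-- Completing the square: the conjugate of `x ↦ ⟨A x, x⟩ / 2 - ⟨b, x⟩` is
`y ↦ ⟨A⁻¹ (y + b), y + b⟩ / 2`. -/
theorem fenchelConjugate_quadFun {A B : E →L[ℝ] E}
    (hA : ∀ x y, inner ℝ (A x) y = inner ℝ x (A y)) (hpos : ∀ x, 0 ≤ inner ℝ (A x) x)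
    (hAB : ∀ x, A (B x) = x) (b y : E) :
    fenchelConjugate (quadFun A b) y = 1 / 2 * inner ℝ (B (y + b)) (y + b) := by
  have key : ∀ x, inner ℝ x y - quadFun A b x = 1 / 2 * inner ℝ (B (y + b)) (y + b)
      - 1 / 2 * inner ℝ (A (x - B (y + b))) (x - B (y + b)) := by
    intro x
    have h1 : inner ℝ (A x) (B (y + b)) = inner ℝ x (y + b) := by rw [hA, hAB]
    simp only [quadFun, map_sub, hAB, inner_sub_left, inner_sub_right, h1]
    rw [real_inner_comm x (y + b), real_inner_comm (B (y + b)) (y + b), inner_add_right x,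
      real_inner_comm b x]
    ring
  have hle : ∀ x, inner ℝ x y - quadFun A b x ≤ 1 / 2 * inner ℝ (B (y + b)) (y + b) := by
    intro x
    rw [key]
    linarith [hpos (x - B (y + b))]
  have hbdd : BddAbove (Set.range fun x => inner ℝ x y - quadFun A b x) :=
    ⟨1 / 2 * inner ℝ (B (y + b)) (y + b), by rintro _ ⟨x, rfl⟩; exact hle x⟩
  refine le_antisymm (ciSup_le hle) (le_ciSup_of_le hbdd (B (y + b)) ?_)
  rw [key]
  simp

variable [CompleteSpace E]

theorem hasGradientAt_quadFun {A : E →L[ℝ] E} (hA : ∀ x y, inner ℝ (A x) y = inner ℝ x (A y))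
    (b x : E) : HasGradientAt (quadFun A b) (A x - b) x := by
  rw [hasGradientAt_iff_hasFDerivAt]
  have h := (((A.hasFDerivAt (x := x)).inner ℝ (hasFDerivAt_id x)).const_mul (1 / 2 : ℝ)).sub
    (((innerSL ℝ) b).hasFDerivAt (x := x))
  refine h.congr_fderiv ?_
  ext y
  have h1 : inner ℝ (A y) x = inner ℝ (A x) y := by rw [hA, real_inner_comm]
  simp [fderivInnerCLM_apply, h1]
  ring

theorem gradient_quadFun {A : E →L[ℝ] E} (hA : ∀ x y, inner ℝ (A x) y = inner ℝ x (A y))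
    (b x : E) : ∇ (quadFun A b) x = A x - b :=
  (hasGradientAt_quadFun hA b x).gradient

theorem gradient_fenchelConjugate_quadFun {A B : E →L[ℝ] E}
    (hA : ∀ x y, inner ℝ (A x) y = inner ℝ x (A y)) (hpos : ∀ x, 0 ≤ inner ℝ (A x) x)
    (hB : ∀ x y, inner ℝ (B x) y = inner ℝ x (B y))
    (hAB : ∀ x, A (B x) = x) (b y : E) :
    ∇ (fenchelConjugate (quadFun A b)) y = B (y + b) := by
  have h1 : fenchelConjugate (quadFun A b)
      = fun y => quadFun B (-(B b)) y + 1 / 2 * inner ℝ (B b) b := by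
    ext y
    rw [fenchelConjugate_quadFun hA hpos hAB]
    have h2 : inner ℝ (B y) b = inner ℝ (B b) y := by rw [hB, real_inner_comm]
    simp only [quadFun, map_add, inner_add_left, inner_add_right, inner_neg_left, h2]
    ring
  rw [h1]
  refine HasGradientAt.gradient ?_
  have h2 := (hasGradientAt_iff_hasFDerivAt.mp (hasGradientAt_quadFun hB (-(B b)) y)).add_const
    (1 / 2 * inner ℝ (B b) b)
  rw [hasGradientAt_iff_hasFDerivAt]
  simpa using h2

end Quadratic

/-! ### Quadratic functions given by a self-adjoint involution -/

section Involution

variable {E : Type*} [NormedAddCommGroup E] [InnerProductSpace ℝ E]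

/-- For a self-adjoint involution `P`, the operator that acts as `α` on the fixed vectors of `P`
and as `β` on the vectors that `P` negates. -/
def twoEigMap (α β : ℝ) (P : E →L[ℝ] E) : E →L[ℝ] E :=
  ((α + β) / 2) • ContinuousLinearMap.id ℝ E - ((β - α) / 2) • P

theorem twoEigMap_apply (α β : ℝ) (P : E →L[ℝ] E) (x : E) :
    twoEigMap α β P x = ((α + β) / 2) • x - ((β - α) / 2) • P x := by
  simp [twoEigMap]

variable {P : E →L[ℝ] E}

theorem inner_twoEigMap_left (hs : ∀ x y, inner ℝ (P x) y = inner ℝ x (P y)) (α β : ℝ) (x y : E) :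
    inner ℝ (twoEigMap α β P x) y = inner ℝ x (twoEigMap α β P y) := by
  simp only [twoEigMap_apply, inner_sub_left, inner_sub_right, inner_smul_left, inner_smul_right,
    hs]
  simp

theorem twoEigMap_twoEigMap_inv (hP : ∀ x, P (P x) = x) {α β : ℝ} (hα : 0 < α) (hβ : 0 < β)
    (x : E) : twoEigMap α β P (twoEigMap α⁻¹ β⁻¹ P x) = x := by
  simp only [twoEigMap_apply, map_sub, map_smul, hP, smul_sub, smul_smul]
  have e1 : (α + β) / 2 * ((α⁻¹ + β⁻¹) / 2) + (β - α) / 2 * ((β⁻¹ - α⁻¹) / 2) = 1 := by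
    field_simp; ring
  have e2 : (α + β) / 2 * ((β⁻¹ - α⁻¹) / 2) + (β - α) / 2 * ((α⁻¹ + β⁻¹) / 2) = 0 := by
    field_simp; ring
  calc _ = ((α + β) / 2 * ((α⁻¹ + β⁻¹) / 2) + (β - α) / 2 * ((β⁻¹ - α⁻¹) / 2)) • x
        - ((α + β) / 2 * ((β⁻¹ - α⁻¹) / 2) + (β - α) / 2 * ((α⁻¹ + β⁻¹) / 2)) • P x := by module
    _ = x := by rw [e1, e2, one_smul, zero_smul, sub_zero]

theorem norm_involution (hP : ∀ x, P (P x) = x) (hs : ∀ x y, inner ℝ (P x) y = inner ℝ x (P y))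
    (x : E) : ‖P x‖ = ‖x‖ := by
  have h : ‖P x‖ ^ 2 = ‖x‖ ^ 2 := by
    rw [← real_inner_self_eq_norm_sq, hs, hP, real_inner_self_eq_norm_sq]
  exact (sq_eq_sq₀ (norm_nonneg _) (norm_nonneg _)).mp h

theorem inner_twoEigMap_self (hP : ∀ x, P (P x) = x)
    (hs : ∀ x y, inner ℝ (P x) y = inner ℝ x (P y)) (α β : ℝ) (x : E) :
    inner ℝ (twoEigMap α β P x) x = α * ‖x‖ ^ 2 + (β - α) / 4 * ‖x - P x‖ ^ 2 := by
  rw [norm_sub_sq_real, norm_involution hP hs, twoEigMap_apply, inner_sub_left, inner_smul_left,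
    inner_smul_left, real_inner_self_eq_norm_sq, real_inner_comm]
  simp
  ring

theorem le_inner_twoEigMap_self (hP : ∀ x, P (P x) = x)
    (hs : ∀ x y, inner ℝ (P x) y = inner ℝ x (P y)) {α β : ℝ} (hαβ : α ≤ β) (x : E) :
    α * ‖x‖ ^ 2 ≤ inner ℝ (twoEigMap α β P x) x := by
  rw [inner_twoEigMap_self hP hs]
  have : 0 ≤ (β - α) / 4 * ‖x - P x‖ ^ 2 := mul_nonneg (by linarith) (sq_nonneg _)
  linarith

theorem strongConvexOn_quadFun_twoEigMap (hP : ∀ x, P (P x) = x)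
    (hs : ∀ x y, inner ℝ (P x) y = inner ℝ x (P y)) {α β : ℝ} (hαβ : α ≤ β) (b : E) :
    StrongConvexOn Set.univ α (quadFun (twoEigMap α β P) b) := by
  rw [strongConvexOn_iff_convex]
  have h : (fun x => quadFun (twoEigMap α β P) b x - α / 2 * ‖x‖ ^ 2)
      = fun x => ((β - α) / 8) • (‖(ContinuousLinearMap.id ℝ E - P : E →L[ℝ] E) x‖ ^ 2)
        + (-(innerSL ℝ b)) x := by
    ext x
    simp only [quadFun, inner_twoEigMap_self hP hs, smul_eq_mul, sub_apply,
      ContinuousLinearMap.id_apply, neg_apply, innerSL_apply_apply]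
    ring
  rw [h]
  have h1 : ConvexOn ℝ Set.univ fun x => ‖(ContinuousLinearMap.id ℝ E - P : E →L[ℝ] E) x‖ ^ 2 := by
    have h2 : ConvexOn ℝ Set.univ fun x : E => ‖x‖ ^ 2 :=
      (convexOn_norm convex_univ).pow (fun _ _ => norm_nonneg _) 2
    exact h2.comp_linearMap ((ContinuousLinearMap.id ℝ E - P : E →L[ℝ] E) : E →ₗ[ℝ] E)
  exact (h1.smul (by linarith)).add ((-(innerSL ℝ b) : E →L[ℝ] ℝ).toLinearMap.convexOn convex_univ)

theorem isSmoothFun_quadFun_twoEigMap [CompleteSpace E] (hP : ∀ x, P (P x) = x)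
    (hs : ∀ x y, inner ℝ (P x) y = inner ℝ x (P y)) {α β : ℝ} (hα : 0 < α) (hαβ : α ≤ β) (b : E) :
    IsSmoothFun β (quadFun (twoEigMap α β P) b) := by
  have hA := inner_twoEigMap_left hs α β
  refine ⟨fun x => (hasGradientAt_quadFun hA b x).differentiableAt, fun x y => ?_⟩
  rw [gradient_quadFun hA, gradient_quadFun hA, sub_sub_sub_cancel_right, ← map_sub,
    twoEigMap_apply]
  refine (norm_sub_le _ _).trans (le_of_eq ?_)
  rw [norm_smul, norm_smul, norm_involution hP hs, Real.norm_of_nonneg (by linarith),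
    Real.norm_of_nonneg (by linarith)]
  ring

/-- Neither a gradient step nor a conjugate gradient step leaves a subspace that contains `b` and
is stable under `P`. -/
theorem gradients_mem_of_stable [CompleteSpace E] (hP : ∀ x, P (P x) = x)
    (hs : ∀ x y, inner ℝ (P x) y = inner ℝ x (P y)) {α β : ℝ} (hα : 0 < α) (hαβ : α ≤ β) {b : E}
    {S : Submodule ℝ E} (hS : ∀ x ∈ S, P x ∈ S) (hb : b ∈ S) {x : E} (hx : x ∈ S) :
    ∇ (quadFun (twoEigMap α β P) b) x ∈ S ∧
      ∇ (fenchelConjugate (quadFun (twoEigMap α β P) b)) x ∈ S := by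
  have hst : ∀ a c : ℝ, ∀ y ∈ S, twoEigMap a c P y ∈ S := fun a c y hy => by
    rw [twoEigMap_apply]
    exact S.sub_mem (S.smul_mem _ hy) (S.smul_mem _ (hS y hy))
  rw [gradient_quadFun (inner_twoEigMap_left hs α β),
    gradient_fenchelConjugate_quadFun (inner_twoEigMap_left hs α β)
      (fun y => (mul_nonneg hα.le (sq_nonneg _)).trans (le_inner_twoEigMap_self hP hs hαβ y))
      (inner_twoEigMap_left hs α⁻¹ β⁻¹)
      (twoEigMap_twoEigMap_inv hP hα (hα.trans_le hαβ))]
  exact ⟨S.sub_mem (hst _ _ x hx) hb, hst _ _ _ (S.add_mem hx hb)⟩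

/-- If `θ` is a critical point of the average of functions `⟨A_i x, x⟩ / 2 - ⟨b, x⟩` with
`α ≤ A_i`, the average grows at least like `α ‖x - θ‖² / 2` away from `θ`. -/
theorem le_averageFun_sub {n : ℕ} (hn : 0 < n) {A : Fin n → E →L[ℝ] E} {α : ℝ}
    (hA : ∀ i x y, inner ℝ (A i x) y = inner ℝ x (A i y))
    (hα : ∀ i x, α * ‖x‖ ^ 2 ≤ inner ℝ (A i x) x) {b θ : E} (hθ : ∑ i, (A i θ - b) = 0) (x : E) :
    α / 2 * ‖x - θ‖ ^ 2
      ≤ averageFun (fun i => quadFun (A i) b) x - averageFun (fun i => quadFun (A i) b) θ := by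
  have hn' : (0 : ℝ) < n := Nat.cast_pos.mpr hn
  rw [averageFun, averageFun, ← mul_sub, ← Finset.sum_sub_distrib]
  have h1 : ∑ i, (quadFun (A i) b x - quadFun (A i) b θ)
      = ∑ i, 1 / 2 * inner ℝ (A i (x - θ)) (x - θ) := by
    simp only [quadFun_sub (hA _)]
    rw [Finset.sum_add_distrib, ← sum_inner, hθ, inner_zero_left, zero_add]
  have h2 : ∑ _i : Fin n, 1 / 2 * (α * ‖x - θ‖ ^ 2)
      ≤ ∑ i, 1 / 2 * inner ℝ (A i (x - θ)) (x - θ) :=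
    Finset.sum_le_sum fun i _ => by linarith [hα i (x - θ)]
  rw [Finset.sum_const, Finset.card_univ, Fintype.card_fin, nsmul_eq_mul] at h2
  rw [h1, one_div, inv_mul_eq_div, le_div_iff₀ hn']
  linarith

end Involution

/-! ### Reindexing and supports in `ℓ²` -/

section Reindex

theorem memℓp_comp_equiv (σ : ℕ ≃ ℕ) (x : lp (fun _ : ℕ => ℝ) 2) :
    Memℓp (E := fun _ : ℕ => ℝ) (fun j => x (σ j)) 2 := by
  have h := lp.memℓp x
  rw [memℓp_gen_iff (by norm_num)] at h ⊢
  exact (σ.summable_iff (f := fun j => ‖x j‖ ^ (2 : ENNReal).toReal)).mpr h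

/-- The operator `x ↦ x ∘ σ` on `ℓ²`, for a permutation `σ` of the coordinates. -/
def reindexL2 (σ : ℕ ≃ ℕ) : lp (fun _ : ℕ => ℝ) 2 →L[ℝ] lp (fun _ : ℕ => ℝ) 2 :=
  LinearMap.mkContinuous
    { toFun := fun x => ⟨fun j => x (σ j), memℓp_comp_equiv σ x⟩
      map_add' := fun _ _ => rfl
      map_smul' := fun _ _ => rfl } 1 (fun x => by
        rw [one_mul, lp.norm_eq_tsum_rpow (by norm_num), lp.norm_eq_tsum_rpow (by norm_num)]
        exact le_of_eq (congrArg (· ^ (1 / (2 : ENNReal).toReal))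
          (σ.tsum_eq (fun j => ‖x j‖ ^ (2 : ENNReal).toReal))))

theorem reindexL2_apply (σ : ℕ ≃ ℕ) (x : lp (fun _ : ℕ => ℝ) 2) (j : ℕ) :
    reindexL2 σ x j = x (σ j) := rfl

theorem reindexL2_reindexL2 {σ : ℕ ≃ ℕ} (hσ : ∀ j, σ (σ j) = j) (x : lp (fun _ : ℕ => ℝ) 2) :
    reindexL2 σ (reindexL2 σ x) = x := by
  ext j
  simp [reindexL2_apply, hσ]

theorem inner_reindexL2_left {σ : ℕ ≃ ℕ} (hσ : ∀ j, σ (σ j) = j)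
    (x y : lp (fun _ : ℕ => ℝ) 2) :
    inner ℝ (reindexL2 σ x) y = inner ℝ x (reindexL2 σ y) := by
  rw [lp.inner_eq_tsum, lp.inner_eq_tsum, ← σ.tsum_eq]
  simp [reindexL2_apply, hσ]

/-- The sequences in `ℓ²` supported on the first `k` coordinates. -/
def coordsBelow (k : ℕ) : Submodule ℝ (lp (fun _ : ℕ => ℝ) 2) where
  carrier := {x | ∀ j, k ≤ j → x j = 0}
  add_mem' := fun {x y} hx hy j hj => by simp [hx j hj, hy j hj]
  zero_mem' := fun j _ => rfl
  smul_mem' := fun c x hx j hj => by simp [hx j hj]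

theorem mem_coordsBelow {k : ℕ} {x : lp (fun _ : ℕ => ℝ) 2} :
    x ∈ coordsBelow k ↔ ∀ j, k ≤ j → x j = 0 := Iff.rfl

theorem coordsBelow_mono {k l : ℕ} (h : k ≤ l) : coordsBelow k ≤ coordsBelow l :=
  fun _ hx j hj => hx j (h.trans hj)

theorem reindexL2_mem_coordsBelow {σ : ℕ ≃ ℕ} {k : ℕ} (hσ : ∀ j, k ≤ j → k ≤ σ j) :
    ∀ x ∈ coordsBelow k, reindexL2 σ x ∈ coordsBelow k :=
  fun x hx j hj => by rw [reindexL2_apply]; exact hx _ (hσ j hj)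

/-- The involution that swaps `2 k` and `2 k + 1`. -/
def swapEven : ℕ ≃ ℕ :=
  Function.Involutive.toPerm (fun j => if j % 2 = 0 then j + 1 else j - 1) fun j => by grind

/-- The involution that fixes `0` and swaps `2 k + 1` and `2 k + 2`. -/
def swapOdd : ℕ ≃ ℕ :=
  Function.Involutive.toPerm
    (fun j => if j = 0 then 0 else if j % 2 = 1 then j + 1 else j - 1) fun j => by grind

theorem swapEven_apply (j : ℕ) : swapEven j = if j % 2 = 0 then j + 1 else j - 1 := rfl

theorem swapOdd_apply (j : ℕ) :
    swapOdd j = if j = 0 then 0 else if j % 2 = 1 then j + 1 else j - 1 := rfl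

theorem memℓp_geometric {q : ℝ} (a : ℝ) (h0 : 0 ≤ q) (h1 : q < 1) :
    Memℓp (E := fun _ : ℕ => ℝ) (fun j => a * q ^ j) 2 := by
  rw [memℓp_gen_iff (by norm_num)]
  have h : Summable fun j : ℕ => a ^ 2 * (q ^ 2) ^ j :=
    (summable_geometric_of_lt_one (sq_nonneg q) (by nlinarith)).mul_left _
  refine h.congr fun j => ?_
  rw [ENNReal.toReal_ofNat, Real.rpow_two, Real.norm_eq_abs, sq_abs]
  ring

/-- The sequence `a, a q, a q ^ 2, …`. -/
def geomL2 (a q : ℝ) (h0 : 0 ≤ q) (h1 : q < 1) : lp (fun _ : ℕ => ℝ) 2 :=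
  ⟨fun j => a * q ^ j, memℓp_geometric a h0 h1⟩

theorem geomL2_apply {a q : ℝ} (h0 : 0 ≤ q) (h1 : q < 1) (j : ℕ) :
    geomL2 a q h0 h1 j = a * q ^ j := rfl

/-- A sequence supported on the first `k` coordinates misses the `k`-th one of `a q ^ j`. -/
theorem sq_le_norm_sub_geomL2_sq {a q : ℝ} (h0 : 0 ≤ q) (h1 : q < 1) {k : ℕ}
    {x : lp (fun _ : ℕ => ℝ) 2} (hx : x ∈ coordsBelow k) :
    (a * q ^ k) ^ 2 ≤ ‖x - geomL2 a q h0 h1‖ ^ 2 := by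
  have h := lp.norm_apply_le_norm (p := 2) (by norm_num) (x - geomL2 a q h0 h1) k
  rw [lp.coeFn_sub, Pi.sub_apply, hx k le_rfl, geomL2_apply, zero_sub, norm_neg,
    Real.norm_eq_abs] at h
  calc (a * q ^ k) ^ 2 = |a * q ^ k| ^ 2 := (sq_abs _).symm
    _ ≤ _ := by gcongr

end Reindex

/-! ### Eigenvalues of Hermitian matrices and the eigengap -/

section Eigengap

open Matrix

variable {n : ℕ} {W : Matrix (Fin n) (Fin n) ℝ}

theorem dotProduct_mulVec_of_isHermitian (hW : W.IsHermitian) (x y : Fin n → ℝ) :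
    x ⬝ᵥ W *ᵥ y = (W *ᵥ x) ⬝ᵥ y := by
  rw [dotProduct_mulVec, ← mulVec_transpose]
  congr 2

theorem eq_zero_of_dotProduct_eigenvectorBasis (hW : W.IsHermitian) {x : Fin n → ℝ}
    (hx : ∀ i, ⇑(hW.eigenvectorBasis i) ⬝ᵥ x = 0) : x = 0 := by
  have h : WithLp.toLp 2 x = 0 := by
    refine InnerProductSpace.ext_inner_left_basis (𝕜 := ℝ) hW.eigenvectorBasis.toBasis fun i => ?_
    rw [inner_zero_right, OrthonormalBasis.coe_toBasis, EuclideanSpace.inner_eq_star_dotProduct]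
    simpa [dotProduct_comm] using hx i
  simpa using h

theorem eigenvectorBasis_dotProduct (hW : W.IsHermitian) (i j : Fin n) :
    ⇑(hW.eigenvectorBasis i) ⬝ᵥ ⇑(hW.eigenvectorBasis j) = if i = j then 1 else 0 := by
  have h := orthonormal_iff_ite.mp hW.eigenvectorBasis.orthonormal i j
  rw [EuclideanSpace.inner_eq_star_dotProduct] at h
  simpa [dotProduct_comm] using h

theorem eigenvectorBasis_ne_zero (hW : W.IsHermitian) (i : Fin n) :
    (⇑(hW.eigenvectorBasis i) : Fin n → ℝ) ≠ 0 := fun h => by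
  simpa [h] using eigenvectorBasis_dotProduct hW i i

theorem exists_eigenvalues_eq (hW : W.IsHermitian) {μ : ℝ} {v : Fin n → ℝ} (hv : v ≠ 0)
    (h : W *ᵥ v = μ • v) : ∃ i, hW.eigenvalues i = μ := by
  by_contra! hne
  refine hv (eq_zero_of_dotProduct_eigenvectorBasis hW fun i => ?_)
  have h1 := dotProduct_mulVec_of_isHermitian hW (⇑(hW.eigenvectorBasis i)) v
  rw [h, hW.mulVec_eigenvectorBasis, dotProduct_smul, smul_dotProduct, smul_eq_mul,
    smul_eq_mul] at h1
  have h2 : (hW.eigenvalues i - μ) * (⇑(hW.eigenvectorBasis i) ⬝ᵥ v) = 0 := by linarith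
  exact (mul_eq_zero.mp h2).resolve_left (sub_ne_zero.mpr (hne i))

/-- If the nonzero eigenvalues of a gossip matrix range from `lo` to `hi`, its eigengap is
`lo / hi`. The kernel being one-dimensional, exactly one eigenvalue vanishes, so `lo` is the
second to last one. -/
theorem IsGossipMatrix.eigengap_eq {G : SimpleGraph (Fin n)} (hG : IsGossipMatrix G W)
    (hn : 2 ≤ n) {lo hi : ℝ} (hlo : 0 < lo) {v w : Fin n → ℝ}
    (hv : v ≠ 0) (hWv : W *ᵥ v = lo • v) (hw : w ≠ 0) (hWw : W *ᵥ w = hi • w)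
    (hbd : ∀ (μ : ℝ) (x : Fin n → ℝ), x ≠ 0 → W *ᵥ x = μ • x → μ ≠ 0 → lo ≤ μ ∧ μ ≤ hi) :
    eigengap hn hG.posSemidef.isHermitian = lo / hi := by
  set hW := hG.posSemidef.isHermitian
  have hcard : Fintype.card (Fin n) = n := Fintype.card_fin n
  let e := Fintype.equivOfCardEq (Fintype.card_fin (Fintype.card (Fin n)))
  have he : ∀ k, hW.eigenvalues (e k) = hW.eigenvalues₀ k := fun k => by
    simp [Matrix.IsHermitian.eigenvalues, e]
  have hmem : ∀ {μ : ℝ} {x : Fin n → ℝ}, x ≠ 0 → W *ᵥ x = μ • x → ∃ k, hW.eigenvalues₀ k = μ :=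
    fun hx h => by
      obtain ⟨i, hi⟩ := exists_eigenvalues_eq hW hx h
      exact ⟨e.symm i, by rw [← he, Equiv.apply_symm_apply, hi]⟩
  have hbd' : ∀ k, hW.eigenvalues₀ k ≠ 0 → lo ≤ hW.eigenvalues₀ k ∧ hW.eigenvalues₀ k ≤ hi :=
    fun k hk => hbd _ _ (eigenvectorBasis_ne_zero hW (e k))
      (by rw [hW.mulVec_eigenvectorBasis, he]) hk
  have hanti := hW.eigenvalues₀_antitone
  have hnonneg : ∀ k, 0 ≤ hW.eigenvalues₀ k := fun k => by
    rw [← he]; exact hG.posSemidef.eigenvalues_nonneg _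
  obtain ⟨kl, hkl⟩ := hmem hv hWv
  obtain ⟨kh, hkh⟩ := hmem hw hWw
  have hhi : lo ≤ hi := by
    have := hbd' kl (by rw [hkl]; exact hlo.ne')
    linarith [this.2]
  obtain ⟨kz, hkz⟩ := hmem (μ := 0) (x := fun _ => 1)
    (fun h => one_ne_zero (congrFun h ⟨0, by omega⟩))
    (by rw [zero_smul]; exact (hG.ker_eq _).mpr ⟨1, rfl⟩)
  let top : Fin (Fintype.card (Fin n)) := ⟨0, by omega⟩
  -- Indices start at `0`: the two smallest eigenvalues are those at `n - 2` and `n - 1`.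
  let snd : Fin (Fintype.card (Fin n)) := ⟨n - 2, by omega⟩
  let last : Fin (Fintype.card (Fin n)) := ⟨n - 1, by omega⟩
  have htop : hW.eigenvalues₀ top = hi := by
    have h1 : hi ≤ hW.eigenvalues₀ top := hkh ▸ hanti (Fin.mk_le_of_le_val (Nat.zero_le _))
    exact le_antisymm (hbd' top (by linarith)).2 h1
  have hlast : hW.eigenvalues₀ last = 0 :=
    le_antisymm (hkz ▸ hanti (Fin.le_def.mpr (by have := kz.2; simp only [last]; omega)))
      (hnonneg _)
  have hsnd0 : hW.eigenvalues₀ snd ≠ 0 := by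
    intro h0
    have hconst : ∀ k, hW.eigenvalues₀ k = 0 →
        ∃ c : ℝ, (⇑(hW.eigenvectorBasis (e k)) : Fin n → ℝ) = fun _ => c := fun k hk =>
      (hG.ker_eq _).mp (by
        rw [← zero_smul ℝ (⇑(hW.eigenvectorBasis (e k)) : Fin n → ℝ), ← hk, ← he]
        exact hW.mulVec_eigenvectorBasis _)
    obtain ⟨c, hc⟩ := hconst snd h0
    obtain ⟨d, hd⟩ := hconst last hlast
    have hne : e snd ≠ e last := fun h => by
      have := congrArg Fin.val (e.injective h)
      simp only [snd, last] at this
      omega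
    have h1 := eigenvectorBasis_dotProduct hW (e snd) (e last)
    have hc0 : c ≠ 0 := fun h => eigenvectorBasis_ne_zero hW (e snd) (by rw [hc, h]; rfl)
    have hd0 : d ≠ 0 := fun h => eigenvectorBasis_ne_zero hW (e last) (by rw [hd, h]; rfl)
    rw [hc, hd, if_neg hne] at h1
    have hn0 : (n : ℝ) ≠ 0 := by positivity
    simp [dotProduct, hc0, hd0, hn0] at h1
  have hsnd : hW.eigenvalues₀ snd = lo := by
    refine le_antisymm ?_ (hbd' snd hsnd0).1
    rw [← hkl]
    refine hanti (Fin.le_def.mpr ?_)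
    by_contra! hlt
    have : kl = last := Fin.ext (by have := kl.2; simp only [snd, last] at hlt ⊢; omega)
    rw [this, hlast] at hkl
    exact hlo.ne hkl
  change hW.eigenvalues₀ snd / hW.eigenvalues₀ top = lo / hi
  rw [hsnd, htop]

end Eigengap

/-! ### The path Laplacian -/

section PathLaplacian

open Matrix

/-- The incidence matrix of the path on `N + 1` vertices: `(D x)_k = x_{k+1} - x_k`. -/
def pathIncidence (N : ℕ) : Matrix (Fin N) (Fin (N + 1)) ℝ :=
  fun k i => (if i = k.succ then 1 else 0) - (if i = k.castSucc then 1 else 0)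

theorem pathIncidence_mulVec {N : ℕ} (x : Fin (N + 1) → ℝ) (k : Fin N) :
    (pathIncidence N *ᵥ x) k = x k.succ - x k.castSucc := by
  simp [pathIncidence, mulVec, dotProduct, sub_mul, Finset.sum_sub_distrib]

/-- The graph Laplacian of the path on `N + 1` vertices. -/
def pathLaplacian (N : ℕ) : Matrix (Fin (N + 1)) (Fin (N + 1)) ℝ :=
  (pathIncidence N)ᴴ * pathIncidence N

theorem posSemidef_pathLaplacian (N : ℕ) : (pathLaplacian N).PosSemidef :=
  posSemidef_conjTranspose_mul_self _

theorem dotProduct_pathLaplacian_mulVec {N : ℕ} (x : Fin (N + 1) → ℝ) :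
    x ⬝ᵥ pathLaplacian N *ᵥ x = ∑ k : Fin N, (x k.succ - x k.castSucc) ^ 2 := by
  rw [pathLaplacian, ← mulVec_mulVec, dotProduct_mulVec, ← mulVec_transpose,
    conjTranspose_eq_transpose_of_trivial, transpose_transpose]
  simp [dotProduct, pathIncidence_mulVec, sq]

theorem pathLaplacian_mulVec_eq_zero {N : ℕ} (x : Fin (N + 1) → ℝ) :
    pathLaplacian N *ᵥ x = 0 ↔ ∃ c : ℝ, x = fun _ => c := by
  rw [pathLaplacian, conjTranspose_mul_self_mulVec_eq_zero]
  constructor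
  · intro h
    refine ⟨x 0, funext fun i => ?_⟩
    induction i using Fin.induction with
    | zero => rfl
    | succ k ih =>
      have := congrFun h k
      rw [pathIncidence_mulVec, Pi.zero_apply] at this
      linarith
  · rintro ⟨c, rfl⟩
    ext k
    simp [pathIncidence_mulVec]

theorem le_of_pathLaplacian_ne_zero {N : ℕ} {i j : Fin (N + 1)} (h : pathLaplacian N i j ≠ 0) :
    (i : ℕ) ≤ j + 1 ∧ (j : ℕ) ≤ i + 1 := by
  rw [pathLaplacian, mul_apply] at h
  obtain ⟨k, -, hk⟩ := Finset.exists_ne_zero_of_sum_ne_zero h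
  have hsupp : ∀ i : Fin (N + 1), pathIncidence N k i ≠ 0 → (i : ℕ) = k + 1 ∨ (i : ℕ) = k := by
    intro i hi
    by_contra! hne
    refine hi ?_
    rw [pathIncidence, if_neg fun h => hne.1 (by rw [h]; rfl),
      if_neg fun h => hne.2 (by rw [h]; rfl), sub_zero]
  have h1 := hsupp i (by simpa using left_ne_zero_of_mul hk)
  have h2 := hsupp j (right_ne_zero_of_mul hk)
  omega

theorem dotProduct_pathLaplacian_mulVec_le {N : ℕ} (x : Fin (N + 1) → ℝ) :
    x ⬝ᵥ pathLaplacian N *ᵥ x ≤ 4 * (x ⬝ᵥ x) := by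
  have h1 : ∑ k : Fin N, x k.succ ^ 2 ≤ x ⬝ᵥ x := by
    simp only [dotProduct, ← sq]
    rw [Fin.sum_univ_succ (fun i => x i ^ 2)]
    linarith [sq_nonneg (x 0)]
  have h2 : ∑ k : Fin N, x k.castSucc ^ 2 ≤ x ⬝ᵥ x := by
    simp only [dotProduct, ← sq]
    rw [Fin.sum_univ_castSucc (fun i => x i ^ 2)]
    linarith [sq_nonneg (x (Fin.last N))]
  have h3 : ∑ k : Fin N, (x k.succ - x k.castSucc) ^ 2
      ≤ ∑ k : Fin N, (2 * x k.succ ^ 2 + 2 * x k.castSucc ^ 2) :=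
    Finset.sum_le_sum fun k _ => by nlinarith [sq_nonneg (x k.succ + x k.castSucc)]
  rw [Finset.sum_add_distrib, ← Finset.mul_sum, ← Finset.mul_sum] at h3
  rw [dotProduct_pathLaplacian_mulVec]
  linarith

theorem sq_sub_zero_le_pathLaplacian {N : ℕ} (x : Fin (N + 1) → ℝ) (i : Fin (N + 1)) :
    (x i - x 0) ^ 2 ≤ N * (x ⬝ᵥ pathLaplacian N *ᵥ x) := by
  have htel : |x i - x 0|
      ≤ ∑ k : Fin N, if (k : ℕ) < i then |x k.succ - x k.castSucc| else 0 := by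
    induction i using Fin.induction with
    | zero => simp
    | succ j ih =>
      have hsplit : ∑ k : Fin N, (if (k : ℕ) < j.succ then |x k.succ - x k.castSucc| else 0)
          = (∑ k : Fin N, if (k : ℕ) < j.castSucc then |x k.succ - x k.castSucc| else 0)
            + |x j.succ - x j.castSucc| := by
        have : |x j.succ - x j.castSucc|
            = ∑ k : Fin N, if k = j then |x k.succ - x k.castSucc| else 0 := by simp
        rw [this, ← Finset.sum_add_distrib]
        refine Finset.sum_congr rfl fun k _ => ?_
        have : k = j ↔ (k : ℕ) = j := Fin.ext_iff
        simp only [Fin.val_succ, Fin.val_castSucc, this]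
        split_ifs <;> first | omega | simp
      rw [hsplit]
      have := abs_add_le (x j.castSucc - x 0) (x j.succ - x j.castSucc)
      rw [show x j.castSucc - x 0 + (x j.succ - x j.castSucc) = x j.succ - x 0 by ring] at this
      linarith
  have hle : |x i - x 0| ≤ ∑ k : Fin N, |x k.succ - x k.castSucc| :=
    htel.trans (Finset.sum_le_sum fun k _ => by split_ifs <;> simp)
  have hcs := sq_sum_le_card_mul_sum_sq (s := Finset.univ)
    (f := fun k : Fin N => |x k.succ - x k.castSucc|)
  simp only [sq_abs, Finset.card_univ, Fintype.card_fin] at hcs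
  rw [dotProduct_pathLaplacian_mulVec]
  calc (x i - x 0) ^ 2 = |x i - x 0| ^ 2 := (sq_abs _).symm
    _ ≤ (∑ k : Fin N, |x k.succ - x k.castSucc|) ^ 2 := by gcongr
    _ ≤ _ := hcs

/-- A Poincaré inequality on the path. -/
theorem dotProduct_le_pathLaplacian {N : ℕ} {x : Fin (N + 1) → ℝ} (hx : ∑ i, x i = 0) :
    x ⬝ᵥ x ≤ ((N : ℝ) + 1) ^ 2 * (x ⬝ᵥ pathLaplacian N *ᵥ x) := by
  have h1 : x ⬝ᵥ x ≤ ∑ i, (x i - x 0) ^ 2 := by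
    have : ∑ i, (x i - x 0) ^ 2 = ∑ i, x i ^ 2 - 2 * x 0 * ∑ i, x i + (N + 1) * x 0 ^ 2 := by
      simp only [sub_sq, Finset.sum_add_distrib, Finset.sum_sub_distrib, Finset.mul_sum]
      simp
      exact Finset.sum_congr rfl fun i _ => by ring
    rw [this, hx]
    simp only [dotProduct, ← sq]
    have : 0 ≤ ((N : ℝ) + 1) * x 0 ^ 2 := by positivity
    linarith
  have h2 : ∑ i, (x i - x 0) ^ 2 ≤ ∑ _i : Fin (N + 1), N * (x ⬝ᵥ pathLaplacian N *ᵥ x) :=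
    Finset.sum_le_sum fun i _ => sq_sub_zero_le_pathLaplacian x i
  rw [Finset.sum_const, Finset.card_univ, Fintype.card_fin, nsmul_eq_mul] at h2
  have h3 : 0 ≤ x ⬝ᵥ pathLaplacian N *ᵥ x := by
    rw [dotProduct_pathLaplacian_mulVec]
    exact Finset.sum_nonneg fun _ _ => sq_nonneg _
  push_cast at h2
  nlinarith [Nat.cast_nonneg (α := ℝ) N]

end PathLaplacian

/-! ### Gossip matrices with a prescribed eigengap -/

section GossipMatrices

open Matrix

/-- The square of the path on `n` vertices: distinct vertices are adjacent when their indices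
differ by at most `2`. -/
def squaredPath (n : ℕ) : SimpleGraph (Fin n) where
  Adj i j := i ≠ j ∧ (i : ℕ) ≤ j + 2 ∧ (j : ℕ) ≤ i + 2
  symm := ⟨fun _ _ h => ⟨h.1.symm, h.2.2, h.2.1⟩⟩
  loopless := ⟨fun _ h => h.1 rfl⟩

theorem connected_squaredPath {n : ℕ} (hn : 0 < n) : (squaredPath n).Connected := by
  obtain ⟨N, rfl⟩ : ∃ N, n = N + 1 := ⟨n - 1, by omega⟩
  refine (SimpleGraph.pathGraph_connected N).mono fun i j h => ?_
  rw [SimpleGraph.pathGraph_adj] at h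
  exact ⟨fun hij => by rw [hij] at h; omega, by omega, by omega⟩

/-- The path Laplacian has two distinct nonzero eigenvalues: otherwise `L (L e₀ - a e₀) = 0`, so
`L e₀ - a e₀` is constant, hence zero as it vanishes at the vertex `2`; but the entries of `L e₀`
sum to `0`. -/
theorem pathLaplacian_mul_ne_smul {N : ℕ} (hN : 2 ≤ N) {a : ℝ} (ha : a ≠ 0) :
    ∃ x, pathLaplacian N *ᵥ pathLaplacian N *ᵥ x ≠ a • pathLaplacian N *ᵥ x := by
  by_contra! h
  set x : Fin (N + 1) → ℝ := Pi.single 0 1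
  have h1 : pathLaplacian N *ᵥ (pathLaplacian N *ᵥ x - a • x) = 0 := by
    rw [mulVec_sub, mulVec_smul, h, sub_self]
  obtain ⟨c, hc⟩ := (pathLaplacian_mulVec_eq_zero _).mp h1
  let two : Fin (N + 1) := ⟨2, by omega⟩
  have hc0 : c = 0 := by
    have h2 := congrFun hc two
    have h3 : pathLaplacian N two 0 = 0 := by
      by_contra h3
      simpa [two] using (le_of_pathLaplacian_ne_zero h3).1
    have h4 : two ≠ 0 := fun h => by simpa [two] using congrArg Fin.val h
    simpa [x, h3, h4] using h2.symm
  have h5 : pathLaplacian N *ᵥ x = a • x := by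
    rw [← sub_eq_zero, hc, hc0]; rfl
  have h6 : (fun _ => (1 : ℝ)) ⬝ᵥ pathLaplacian N *ᵥ x = 0 := by
    rw [dotProduct_mulVec_of_isHermitian (posSemidef_pathLaplacian N).isHermitian,
      (pathLaplacian_mulVec_eq_zero _).mpr ⟨1, rfl⟩, zero_dotProduct]
  rw [h5] at h6
  simp [dotProduct, x, Pi.single_apply] at h6
  exact ha h6

/-- Eigengaps `γ ≤ 1 / (4 n²)` are attained by a polynomial `c₀ L + c₁ L²` in the Laplacian `L` of
the path. Its nonzero eigenvalues lie between some `a ≥ 1 / n²` and `b ≤ 4`, and the polynomial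
`x (γ / a + c₁ (x - a))`, with `c₁ ≥ 0` such that it takes the value `1` at `b`, is increasing on
`[a, b]`. -/
theorem exists_isGossipMatrix_of_le {n : ℕ} (hn : 3 ≤ n) {γ : ℝ} (hγ : 0 < γ)
    (hγn : 4 * (n : ℝ) ^ 2 * γ ≤ 1) :
    ∃ (W : Matrix (Fin n) (Fin n) ℝ) (hW : IsGossipMatrix (squaredPath n) W),
      eigengap (by omega) hW.posSemidef.isHermitian = γ := by
  obtain ⟨N, rfl⟩ : ∃ N, n = N + 1 := ⟨n - 1, by omega⟩
  set L := pathLaplacian N with hLdef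
  have hL : L.IsHermitian := (posSemidef_pathLaplacian N).isHermitian
  set u : Fin (N + 1) → Fin (N + 1) → ℝ := fun i => ⇑(hL.eigenvectorBasis i) with hu
  set l := hL.eigenvalues with hl
  have hLu : ∀ i, L *ᵥ u i = l i • u i := hL.mulVec_eigenvectorBasis
  have huu : ∀ i, u i ⬝ᵥ u i = 1 := fun i => by
    simpa using eigenvectorBasis_dotProduct hL i i
  have hl0 : ∀ i, 0 ≤ l i := (posSemidef_pathLaplacian N).eigenvalues_nonneg
  have huL : ∀ i x, u i ⬝ᵥ L *ᵥ x = l i * (u i ⬝ᵥ x) := fun i x => by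
    rw [dotProduct_mulVec_of_isHermitian hL, hLu, smul_dotProduct, smul_eq_mul]
  have hext : ∀ x y : Fin (N + 1) → ℝ, (∀ i, u i ⬝ᵥ x = u i ⬝ᵥ y) → x = y := fun x y h =>
    sub_eq_zero.mp (eq_zero_of_dotProduct_eigenvectorBasis hL fun i => by
      rw [dotProduct_sub]; exact sub_eq_zero.mpr (h i))
  -- The least and the greatest nonzero eigenvalue.
  have hne : (Finset.univ.filter fun i => l i ≠ 0).Nonempty := by
    rw [Finset.filter_nonempty_iff]
    by_contra! h
    obtain ⟨x, hx⟩ := pathLaplacian_mul_ne_smul (N := N) (by omega) one_ne_zero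
    exact hx (hext _ _ fun i => by
      rw [dotProduct_smul, huL, huL, h i (Finset.mem_univ i)]; simp)
  obtain ⟨ia, hia, hmin⟩ := Finset.exists_min_image _ l hne
  obtain ⟨ib, hib, hmax⟩ := Finset.exists_max_image _ l hne
  simp only [Finset.mem_filter, Finset.mem_univ, true_and] at hia hib hmin hmax
  set a := l ia with ha_def
  set b := l ib with hb_def
  have ha : 0 < a := (hl0 ia).lt_of_ne' hia
  have hb : 0 < b := (hl0 ib).lt_of_ne' hib
  have hab : a < b := by
    refine (hmin ib hib).lt_of_ne fun hab => ?_
    obtain ⟨x, hx⟩ := pathLaplacian_mul_ne_smul (N := N) (by omega) ha.ne'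
    refine hx (hext _ _ fun i => ?_)
    rw [dotProduct_smul, huL, huL, smul_eq_mul]
    by_cases hi : l i = 0
    · rw [hi]; ring
    · rw [le_antisymm (hab ▸ hmax i hi) (hmin i hi)]
  have hb4 : b ≤ 4 := by
    have h := dotProduct_pathLaplacian_mulVec_le (u ib)
    rw [← hLdef, huL, huu] at h
    linarith
  have ha1 : 1 ≤ ((N : ℝ) + 1) ^ 2 * a := by
    have hsum : ∑ k, u ia k = 0 := by
      have h := huL ia fun _ => 1
      rw [(pathLaplacian_mulVec_eq_zero _).mpr ⟨1, rfl⟩, dotProduct_zero] at h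
      simpa [dotProduct] using (mul_eq_zero.mp h.symm).resolve_left ha.ne'
    have h := dotProduct_le_pathLaplacian hsum
    rwa [← hLdef, huL, huu, mul_one] at h
  have hγab : γ * b ≤ a := by
    push_cast at hγn
    have h1 : ((N : ℝ) + 1) ^ 2 * (γ * b) ≤ ((N : ℝ) + 1) ^ 2 * a := by
      nlinarith [mul_le_mul_of_nonneg_left hb4 (by positivity : 0 ≤ ((N : ℝ) + 1) ^ 2 * γ)]
    exact le_of_mul_le_mul_left h1 (by positivity)
  set c₁ : ℝ := (1 / b - γ / a) / (b - a) with hc₁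
  have hc₁0 : 0 ≤ c₁ := by
    refine div_nonneg (sub_nonneg.mpr ?_) (by linarith)
    rw [div_le_div_iff₀ ha hb]
    linarith
  have hc₁b : γ / a + c₁ * (b - a) = 1 / b := by
    rw [hc₁, div_mul_cancel₀ _ (by linarith)]; ring
  set p : ℝ → ℝ := fun x => x * (γ / a + c₁ * (x - a)) with hp
  have hpa : p a = γ := by simp only [hp]; field_simp; ring
  have hpb : p b = 1 := by simp only [hp]; rw [hc₁b]; field_simp
  have hpbd : ∀ i, l i ≠ 0 → γ ≤ p (l i) ∧ p (l i) ≤ 1 := by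
    intro i hi
    have h1 := hmin i hi
    have h2 := hmax i hi
    have hγa : 0 < γ / a := div_pos hγ ha
    have h3 : 0 ≤ c₁ * (l i - a) := mul_nonneg hc₁0 (by linarith)
    rw [← hpa, ← hpb]
    simp only [hp]
    constructor
    · exact mul_le_mul h1 (by simpa using h3) (by simpa using hγa.le) (hl0 i)
    · exact mul_le_mul h2 (by gcongr) (by positivity) hb.le
  set W : Matrix (Fin (N + 1)) (Fin (N + 1)) ℝ := (γ / a - c₁ * a) • L + c₁ • (L * L) with hWdef
  have hWx : ∀ x, W *ᵥ x = (γ / a - c₁ * a) • L *ᵥ x + c₁ • L *ᵥ L *ᵥ x := fun x => by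
    rw [hWdef, add_mulVec, smul_mulVec, smul_mulVec, mulVec_mulVec]
  have huW : ∀ i x, u i ⬝ᵥ W *ᵥ x = p (l i) * (u i ⬝ᵥ x) := fun i x => by
    rw [hWx, dotProduct_add, dotProduct_smul, dotProduct_smul, huL, huL, huL, smul_eq_mul,
      smul_eq_mul]
    simp only [hp]
    ring
  have hWu : ∀ i, W *ᵥ u i = p (l i) • u i := fun i => by
    rw [hWx, hLu, mulVec_smul, hLu]
    simp only [hp, smul_smul, ← add_smul]
    congr 1
    ring
  have hu0 : ∀ i, u i ≠ 0 := eigenvectorBasis_ne_zero hL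
  have hWsymm : W.IsHermitian := by
    have h1 : (L * L).IsHermitian := by
      rw [Matrix.IsHermitian, conjTranspose_mul, hL.eq]
    rw [Matrix.IsHermitian, hWdef, conjTranspose_add, conjTranspose_smul, conjTranspose_smul,
      hL.eq, h1.eq]
    rfl
  -- Every eigenvector of `W` has a nonzero component along some `u i`.
  have hspec : ∀ (μ : ℝ) (x : Fin (N + 1) → ℝ), x ≠ 0 → W *ᵥ x = μ • x → ∃ i, μ = p (l i) := by
    intro μ x hx h
    by_contra! hμ
    refine hx (hext _ _ fun i => ?_)
    have h1 := huW i x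
    rw [h, dotProduct_smul, smul_eq_mul] at h1
    have h2 : (μ - p (l i)) * (u i ⬝ᵥ x) = 0 := by linarith
    rw [(mul_eq_zero.mp h2).resolve_left (sub_ne_zero.mpr (hμ i)), dotProduct_zero]
  have hp0 : p 0 = 0 := by simp [hp]
  have hW : IsGossipMatrix (squaredPath (N + 1)) W := by
    refine ⟨by simpa [Matrix.IsSymm] using hWsymm.eq, ?_, fun x => ⟨fun h => ?_, ?_⟩,
      fun i j hij => ?_⟩
    · rw [hWsymm.posSemidef_iff_eigenvalues_nonneg]
      intro i
      obtain ⟨j, hj⟩ := hspec _ _ (eigenvectorBasis_ne_zero hWsymm i)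
        (hWsymm.mulVec_eigenvectorBasis i)
      rw [Pi.zero_apply, hj]
      by_cases h0 : l j = 0
      · rw [h0, hp0]
      · exact hγ.le.trans (hpbd j h0).1
    · refine (pathLaplacian_mulVec_eq_zero x).mp (hext _ _ fun i => ?_)
      rw [← hLdef, huL, dotProduct_zero]
      have h1 := huW i x
      rw [h, dotProduct_zero] at h1
      by_cases h0 : l i = 0
      · rw [h0, zero_mul]
      · rw [(mul_eq_zero.mp h1.symm).resolve_left (hγ.trans_le (hpbd i h0).1).ne', mul_zero]
    · intro hx
      have h0 : L *ᵥ x = 0 := (pathLaplacian_mulVec_eq_zero x).mpr hx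
      rw [hWx, h0]
      simp
    · by_cases hij' : i = j
      · exact Or.inl hij'
      · refine Or.inr ⟨hij', ?_⟩
        by_cases h1 : L i j = 0
        · have h2 : (L * L) i j ≠ 0 := fun h2 => hij (by simp [hWdef, h1, h2])
          rw [mul_apply] at h2
          obtain ⟨k, -, hk⟩ := Finset.exists_ne_zero_of_sum_ne_zero h2
          have h3 := le_of_pathLaplacian_ne_zero (left_ne_zero_of_mul hk)
          have h4 := le_of_pathLaplacian_ne_zero (right_ne_zero_of_mul hk)
          omega
        · have h3 := le_of_pathLaplacian_ne_zero h1
          omega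
  refine ⟨W, hW, ?_⟩
  rw [hW.eigengap_eq (by omega) hγ (hu0 ia) (by rw [hWu, ← ha_def, hpa]) (hu0 ib)
    (by rw [hWu, ← hb_def, hpb]), div_one]
  intro μ x hx h hμ
  obtain ⟨i, rfl⟩ := hspec μ x hx h
  exact hpbd i fun h0 => hμ (by rw [h0, hp0])

/-- On three nodes every eigengap is attained, by the matrix with eigenvectors `(1, 1, 1)`,
`(1, 0, -1)`, `(1, -2, 1)` and eigenvalues `0`, `γ`, `1`. -/
theorem exists_isGossipMatrix_three {γ : ℝ} (hγ : 0 < γ) (hγ1 : γ ≤ 1) :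
    ∃ (W : Matrix (Fin 3) (Fin 3) ℝ) (hW : IsGossipMatrix (squaredPath 3) W),
      eigengap (by omega) hW.posSemidef.isHermitian = γ := by
  set v : Fin 3 → ℝ := ![1, 0, -1] with hv
  set w : Fin 3 → ℝ := ![1, -2, 1] with hw
  set W : Matrix (Fin 3) (Fin 3) ℝ := (γ / 2) • vecMulVec v (star v)
    + (1 / 6 : ℝ) • vecMulVec w (star w) with hWdef
  have hWx : ∀ x, W *ᵥ x = (γ / 2 * (v ⬝ᵥ x)) • v + (1 / 6 * (w ⬝ᵥ x)) • w := fun x => by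
    ext i
    fin_cases i <;>
      simp [hWdef, hv, hw, mulVec, dotProduct, Fin.sum_univ_three] <;> ring
  have hvv : v ⬝ᵥ v = 2 := by simp [hv, dotProduct, Fin.sum_univ_three]; norm_num
  have hww : w ⬝ᵥ w = 6 := by simp [hw, dotProduct, Fin.sum_univ_three]; norm_num
  have hvw : v ⬝ᵥ w = 0 := by simp [hv, hw, dotProduct, Fin.sum_univ_three]
  have hwv : w ⬝ᵥ v = 0 := by rw [dotProduct_comm, hvw]
  have hWv : W *ᵥ v = γ • v := by
    rw [hWx, hvv, hwv]; simp
  have hWw : W *ᵥ w = (1 : ℝ) • w := by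
    rw [hWx, hww, hvw]; simp
  have hvW : ∀ x, v ⬝ᵥ W *ᵥ x = γ * (v ⬝ᵥ x) := fun x => by
    rw [hWx, dotProduct_add, dotProduct_smul, dotProduct_smul, hvv, hvw]
    simp only [smul_eq_mul]
    ring
  have hwW : ∀ x, w ⬝ᵥ W *ᵥ x = w ⬝ᵥ x := fun x => by
    rw [hWx, dotProduct_add, dotProduct_smul, dotProduct_smul, hwv, hww]
    simp only [smul_eq_mul]
    ring
  have hW : IsGossipMatrix (squaredPath 3) W := by
    have hpsd : W.PosSemidef := ((posSemidef_vecMulVec_self_star v).smul (by positivity)).add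
      ((posSemidef_vecMulVec_self_star w).smul (by positivity))
    refine ⟨by simpa [Matrix.IsSymm] using hpsd.isHermitian.eq, hpsd,
      fun x => ⟨fun h => ⟨x 0, ?_⟩, ?_⟩, fun i j _ => ?_⟩
    · have h1 : v ⬝ᵥ x = 0 := by
        have := hvW x
        rw [h, dotProduct_zero] at this
        exact (mul_eq_zero.mp this.symm).resolve_left hγ.ne'
      have h2 : w ⬝ᵥ x = 0 := by rw [← hwW, h, dotProduct_zero]
      simp [hv, hw, dotProduct, Fin.sum_univ_three] at h1 h2
      ext i
      fin_cases i <;> simp <;> linarith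
    · rintro ⟨c, rfl⟩
      rw [hWx]
      have h1 : v ⬝ᵥ (fun _ => c) = 0 := by simp [hv, dotProduct, Fin.sum_univ_three]
      have h2 : w ⬝ᵥ (fun _ => c) = 0 := by simp [hw, dotProduct, Fin.sum_univ_three]; ring
      rw [h1, h2]; simp
    · exact or_iff_not_imp_left.mpr fun h => ⟨h, by omega, by omega⟩
  refine ⟨W, hW, ?_⟩
  rw [hW.eigengap_eq (by omega) hγ (fun h => by rw [h] at hvv; simp at hvv) hWv
    (fun h => by rw [h] at hww; simp at hww) hWw, div_one]
  intro μ x hx h hμ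
  by_cases h1 : v ⬝ᵥ x = 0
  · by_cases h2 : w ⬝ᵥ x = 0
    · rw [hWx, h1, h2] at h
      simp only [mul_zero, zero_smul, add_zero] at h
      exact absurd h.symm (smul_ne_zero hμ hx)
    · have h3 := hwW x
      rw [h, dotProduct_smul, smul_eq_mul] at h3
      have : μ = 1 := mul_right_cancel₀ h2 (by linarith)
      exact ⟨by linarith, by linarith⟩
  · have h3 := hvW x
    rw [h, dotProduct_smul, smul_eq_mul] at h3
    have : μ = γ := mul_right_cancel₀ h1 (by linarith)
    exact ⟨by linarith, by linarith⟩

/-- Every eigengap `γ` is attained on a squared path whose length is at least of order `1 / √γ`. -/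
theorem exists_isGossipMatrix {γ : ℝ} (hγ : 0 < γ) (hγ1 : γ ≤ 1) :
    ∃ (m : ℕ) (hm : 1 ≤ m) (W : Matrix (Fin (3 * m)) (Fin (3 * m)) ℝ)
      (hW : IsGossipMatrix (squaredPath (3 * m)) W),
      eigengap (by omega) hW.posSemidef.isHermitian = γ ∧ 1 / Real.sqrt γ ≤ 12 * m := by
  have hs : 0 < Real.sqrt γ := Real.sqrt_pos.mpr hγ
  have hsq : Real.sqrt γ ^ 2 = γ := Real.sq_sqrt hγ.le
  by_cases hbig : 1 < 6 * Real.sqrt γ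
  · obtain ⟨W, hW, h⟩ := exists_isGossipMatrix_three hγ hγ1
    refine ⟨1, le_rfl, W, hW, h, ?_⟩
    rw [div_le_iff₀ hs]
    push_cast
    linarith
  · push Not at hbig
    set m := ⌊1 / (6 * Real.sqrt γ)⌋₊ with hm
    have hone : 1 ≤ 1 / (6 * Real.sqrt γ) := by rwa [le_div_iff₀ (by positivity), one_mul]
    have hm1 : 1 ≤ m := Nat.one_le_floor_iff _ |>.mpr hone
    have hmle : (m : ℝ) ≤ 1 / (6 * Real.sqrt γ) := Nat.floor_le (by positivity)
    have hmlt : 1 / (6 * Real.sqrt γ) < m + 1 := Nat.lt_floor_add_one _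
    rw [le_div_iff₀ (by positivity)] at hmle
    rw [div_lt_iff₀ (by positivity)] at hmlt
    have hm1' : (1 : ℝ) ≤ m := by exact_mod_cast hm1
    obtain ⟨W, hW, h⟩ := exists_isGossipMatrix_of_le (n := 3 * m) (by omega) hγ (by
      push_cast
      calc 4 * (3 * (m : ℝ)) ^ 2 * γ = (m * (6 * Real.sqrt γ)) ^ 2 := by
            rw [mul_pow (m : ℝ), mul_pow 6, hsq]; ring
        _ ≤ 1 := pow_le_one₀ (by positivity) hmle)
    refine ⟨m, hm1, W, hW, h, ?_⟩
    rw [div_le_iff₀ hs]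
    nlinarith

end GossipMatrices

/-! ### The hard instance and the lower bound -/

section LowerBound

/-- The involution that defines the function of node `i` among `3 m` nodes: the first third
couples the coordinates `2 k + 1, 2 k + 2`, the last third the coordinates `2 k, 2 k + 1`, and the
middle third couples nothing. -/
def nodeSwap (m i : ℕ) : ℕ ≃ ℕ :=
  if i < m then swapOdd else if i < 2 * m then Equiv.refl ℕ else swapEven

theorem swapEven_swapEven (j : ℕ) : swapEven (swapEven j) = j := by
  simp only [swapEven_apply]; grind

theorem swapOdd_swapOdd (j : ℕ) : swapOdd (swapOdd j) = j := by
  simp only [swapOdd_apply]; grind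

theorem nodeSwap_nodeSwap (m i j : ℕ) : nodeSwap m i (nodeSwap m i j) = j := by
  unfold nodeSwap
  split_ifs
  exacts [swapOdd_swapOdd j, rfl, swapEven_swapEven j]

theorem sum_nodeSwap {M : Type*} [AddCommMonoid M] (m : ℕ) (g : (ℕ ≃ ℕ) → M) :
    ∑ i : Fin (3 * m), g (nodeSwap m i)
      = m • (g swapOdd + g (Equiv.refl ℕ) + g swapEven) := by
  rw [Fin.sum_univ_eq_sum_range (fun i => g (nodeSwap m i)), show 3 * m = m + m + m by ring,
    Finset.sum_range_add, Finset.sum_range_add, smul_add, smul_add]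
  congr 1
  · congr 1
    · rw [← Finset.card_range m, ← Finset.sum_const, Finset.card_range]
      refine Finset.sum_congr rfl fun i hi => ?_
      rw [nodeSwap, if_pos (Finset.mem_range.mp hi)]
    · rw [← Finset.card_range m, ← Finset.sum_const, Finset.card_range]
      refine Finset.sum_congr rfl fun i hi => ?_
      have := Finset.mem_range.mp hi
      rw [nodeSwap, if_neg (by omega), if_pos (by omega)]
  · rw [← Finset.card_range m, ← Finset.sum_const, Finset.card_range]
    refine Finset.sum_congr rfl fun i _ => ?_
    rw [nodeSwap, if_neg (by omega), if_neg (by omega)]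

/-- Half the signed difference of indices between node `i` and the nodes that can pass from the
first `k` coordinates to the next one (the first third of the nodes for even `k`, the last
third for odd `k`): nonpositive on these nodes, at least `m / 2` on the opposite third, and growing
by at most `1` along an edge. -/
def hopBound (m k i : ℕ) : ℝ :=
  if Even k then ((i : ℝ) - m) / 2 else (2 * (m : ℝ) - i) / 2

theorem hopBound_le_add_one {m k i j : ℕ} (h1 : i ≤ j + 2) (h2 : j ≤ i + 2) :
    hopBound m k i ≤ hopBound m k j + 1 := by
  have h1' : (i : ℝ) ≤ j + 2 := by exact_mod_cast h1
  have h2' : (j : ℝ) ≤ i + 2 := by exact_mod_cast h2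
  unfold hopBound
  split_ifs <;> linarith

theorem neg_le_hopBound {m k i : ℕ} (hi : i < 3 * m) : -((m : ℝ) / 2) ≤ hopBound m k i := by
  have h1 : (i : ℝ) ≤ 3 * m := by exact_mod_cast hi.le
  have h2 : (0 : ℝ) ≤ i := Nat.cast_nonneg i
  unfold hopBound
  split_ifs <;> linarith

/-- A node either keeps the first `k` coordinates, or it is one of the nodes that can reveal the
next coordinate; in that case it keeps the first `k - 1` coordinates and lies far from the nodes
that can pass from `k - 1` to `k` coordinates. -/
theorem nodeSwap_dichotomy {m k i : ℕ} :
    (∀ j, k ≤ j → k ≤ nodeSwap m i j) ∨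
      (hopBound m k i ≤ 0 ∧ ∀ l, k = l + 1 →
        (m : ℝ) / 2 ≤ hopBound m l i ∧ ∀ j, l ≤ j → l ≤ nodeSwap m i j) := by
  unfold nodeSwap
  by_cases h1 : i < m
  · have h1' : (i : ℝ) ≤ m := by exact_mod_cast h1.le
    simp only [if_pos h1, swapOdd_apply]
    by_cases hk : Even k
    · refine Or.inr ⟨by rw [hopBound, if_pos hk]; linarith, ?_⟩
      rintro l rfl
      have hl : ¬ Even l := by rwa [Nat.even_add_one] at hk
      refine ⟨by rw [hopBound, if_neg hl]; linarith, fun j hj => ?_⟩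
      rw [Nat.even_iff] at hl
      grind
    · left
      intro j hj
      rw [Nat.even_iff] at hk
      grind
  · by_cases h2 : i < 2 * m
    · left
      simp only [if_neg h1, if_pos h2]
      exact fun j hj => hj
    · have h2' : 2 * (m : ℝ) ≤ i := by exact_mod_cast not_lt.mp h2
      simp only [if_neg h1, if_neg h2, swapEven_apply]
      by_cases hk : Even k
      · left
        intro j hj
        rw [Nat.even_iff] at hk
        grind
      · refine Or.inr ⟨by rw [hopBound, if_neg hk]; linarith, ?_⟩
        rintro l rfl
        have hl : Even l := by rwa [Nat.even_add_one, not_not] at hk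
        refine ⟨by rw [hopBound, if_pos hl]; linarith, fun j hj => ?_⟩
        rw [Nat.even_iff] at hl
        grind

/-- The function of node `i`: its Hessian is `α` or `β` along the symmetric or antisymmetric vectors
for the swaps of node `i`. All nodes share the linear term `b`. -/
def nodeFun (m : ℕ) (α β : ℝ) (b : lp (fun _ : ℕ => ℝ) 2) (i : Fin (3 * m)) :
    lp (fun _ : ℕ => ℝ) 2 → ℝ :=
  quadFun (twoEigMap α β (reindexL2 (nodeSwap m i))) b

/-- Passing from `k` to `k + 1` known coordinates takes one computation on the right third of the
nodes, and `m / 2` communications to get there from the opposite third. The induction is on time,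
in steps of the shorter of the two durations. -/
theorem memory_subset_coordsBelow {m : ℕ} {W : Matrix (Fin (3 * m)) (Fin (3 * m)) ℝ}
    (hW : IsGossipMatrix (squaredPath (3 * m)) W) {α β : ℝ} (hα : 0 < α) (hαβ : α ≤ β)
    {b : lp (fun _ : ℕ => ℝ) 2} (hb : b ∈ coordsBelow 1) {τ : ℝ} (hτ : 0 < τ)
    (P : BlackBoxProcedure W τ (nodeFun m α β b)) {k : ℕ} (hk : 1 ≤ k) {t : ℝ} (ht : 0 ≤ t)
    (i : Fin (3 * m)) (htk : t < ((k : ℝ) - 1) * (1 + m / 2 * τ) + τ * hopBound m k i) :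
    P.memory i t ⊆ coordsBelow k := by
  have hδ : 0 < min 1 τ := lt_min one_pos hτ
  obtain ⟨N, hN⟩ : ∃ N : ℕ, t ≤ N * min 1 τ := by
    obtain ⟨N, hN⟩ := exists_nat_ge (t / min 1 τ)
    exact ⟨N, by rwa [div_le_iff₀ hδ] at hN⟩
  induction N generalizing t k i with
  | zero =>
    have h0 : t = 0 := le_antisymm (by simpa using hN) ht
    rw [h0, P.memory_zero, Set.singleton_subset_iff]
    exact (coordsBelow k).zero_mem
  | succ N ih =>
    rcases ht.eq_or_lt with h0 | hpos
    · rw [← h0, P.memory_zero, Set.singleton_subset_iff]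
      exact (coordsBelow k).zero_mem
    push_cast at hN
    refine (P.memory_subset i t hpos).trans (Set.union_subset ?_ ?_)
    · refine SetLike.coe_subset_coe.mpr (Submodule.span_le.mpr ?_)
      rintro v ⟨s, hs0, hs, θ, hθ, hv⟩
      have hsN : s ≤ N * min 1 τ := by linarith [min_le_left 1 τ]
      have hθk : θ ∈ coordsBelow k := ih hk hs0 i (by linarith) hsN hθ
      have hgrad : ∀ {l : ℕ}, 1 ≤ l → (∀ j, l ≤ j → l ≤ nodeSwap m i j) → θ ∈ coordsBelow l →
          ∇ (nodeFun m α β b i) θ ∈ coordsBelow l ∧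
            ∇ (fenchelConjugate (nodeFun m α β b i)) θ ∈ coordsBelow l := fun hl hsw hθl =>
        gradients_mem_of_stable (reindexL2_reindexL2 (nodeSwap_nodeSwap m i))
          (inner_reindexL2_left (nodeSwap_nodeSwap m i)) hα hαβ
          (reindexL2_mem_coordsBelow hsw) (coordsBelow_mono hl hb) hθl
      have hboth : ∇ (nodeFun m α β b i) θ ∈ coordsBelow k ∧
          ∇ (fenchelConjugate (nodeFun m α β b i)) θ ∈ coordsBelow k := by
        rcases nodeSwap_dichotomy (m := m) (k := k) (i := i) with hsw | ⟨hle, hprev⟩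
        · exact hgrad hk hsw hθk
        · obtain ⟨l, rfl⟩ : ∃ l, k = l + 1 := ⟨k - 1, by omega⟩
          obtain ⟨hge, hsw⟩ := hprev l rfl
          have hτle := mul_nonpos_of_nonneg_of_nonpos hτ.le hle
          have hτge := mul_le_mul_of_nonneg_left hge hτ.le
          push_cast at htk
          rcases Nat.eq_zero_or_pos l with rfl | hl
          · norm_num at htk
            linarith
          · have hθl : θ ∈ coordsBelow l := ih hl hs0 i (by linarith) hsN hθ
            have h := hgrad hl hsw hθl
            exact ⟨coordsBelow_mono l.le_succ h.1, coordsBelow_mono l.le_succ h.2⟩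
      rcases hv with rfl | rfl | rfl
      exacts [hθk, hboth.1, hboth.2]
    · refine SetLike.coe_subset_coe.mpr (Submodule.span_le.mpr ?_)
      rintro v ⟨s, x, hsx, rfl⟩
      refine Submodule.sum_mem _ fun j _ => ?_
      by_cases hij : W i j = 0
      · rw [hij, zero_smul]
        exact (coordsBelow k).zero_mem
      · obtain ⟨hs0, hs, hx⟩ := hsx j
        have hhop : hopBound m k i ≤ hopBound m k j + 1 := by
          rcases hW.support i j hij with rfl | hadj
          · linarith
          · exact hopBound_le_add_one hadj.2.1 hadj.2.2
        have hτhop := mul_le_mul_of_nonneg_left hhop hτ.le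
        exact (coordsBelow k).smul_mem _
          (ih hk hs0 j (by linarith) (by linarith [min_le_right 1 τ]) hx)

/-- The second-order recurrence for `q ^ j` is the critical point equation of the average at every
coordinate but the first, where the linear term is chosen to make it hold. -/
theorem sum_twoEigMap_geomL2_sub {α β a q : ℝ} (h0 : 0 ≤ q) (h1 : q < 1)
    (hq : (β - α) * (1 - q) ^ 2 = 6 * α * q) (m : ℕ) :
    ∑ i : Fin (3 * m), (twoEigMap α β (reindexL2 (nodeSwap m i)) (geomL2 a q h0 h1)
      - lp.single 2 0 (((5 * α + β) * a - (β - α) * (a * q)) / 6)) = 0 := by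
  refine (sum_nodeSwap m fun σ => twoEigMap α β (reindexL2 σ) (geomL2 a q h0 h1)
    - lp.single (E := fun _ : ℕ => ℝ) 2 0 (((5 * α + β) * a - (β - α) * (a * q)) / 6)).trans ?_
  convert smul_zero m
  ext j
  simp only [twoEigMap_apply, lp.coeFn_add, lp.coeFn_sub, lp.coeFn_smul, Pi.add_apply,
    Pi.sub_apply, Pi.smul_apply, reindexL2_apply, geomL2_apply, lp.coeFn_zero, Pi.zero_apply,
    lp.coeFn_single, smul_eq_mul, Equiv.refl_apply, swapOdd_apply, swapEven_apply]
  rcases j with _ | j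
  · simp
    ring
  · rw [Pi.single_eq_of_ne (by omega)]
    have key : a * q ^ j * ((β - α) * (1 - q) ^ 2 - 6 * α * q) = 0 := by rw [hq]; ring
    rcases Nat.even_or_odd' j with ⟨r, rfl | rfl⟩
    · rw [if_neg (by omega), if_pos (by omega), if_neg (by omega), Nat.add_sub_cancel]
      linear_combination (-1 / 2) * key
    · rw [if_neg (by omega), if_neg (by omega), if_pos (by omega), Nat.add_sub_cancel]
      linear_combination (-1 / 2) * key

/-- The ratio `q` tends to `1` like `1 - O(1 / √κ)` as the condition number `κ = β / α` grows. -/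
theorem exists_ratio {κ₀ α β : ℝ} (hκ₀ : 1 < κ₀) (hα : 0 < α) (hκ : κ₀ ≤ β / α) :
    ∃ q : ℝ, 0 < q ∧ q < 1 ∧ (β - α) * (1 - q) ^ 2 = 6 * α * q ∧
      Real.sqrt (β / α) * -Real.log q ≤ 6 * κ₀ / (κ₀ - 1) + Real.sqrt (6 * κ₀ / (κ₀ - 1)) := by
  have hκ1 : 1 < β / α := hκ₀.trans_le hκ
  have hβα : 0 < β - α := by rw [lt_div_iff₀ hα] at hκ1; linarith
  set κ := β / α with hκdef
  set K := 6 * κ₀ / (κ₀ - 1) with hK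
  have hK0 : 0 < K := div_pos (by linarith) (by linarith)
  set μ := 6 * α / (β - α) with hμ
  have hμ0 : 0 < μ := by positivity
  have hμα : μ * (β - α) = 6 * α := div_mul_cancel₀ _ hβα.ne'
  have hμκ : κ * μ ≤ K := by
    have h1 : κ * μ = 6 * κ / (κ - 1) := by
      rw [hμ, hκdef]; field_simp
    rw [h1, hK, div_le_div_iff₀ (by linarith) (by linarith)]
    nlinarith
  -- `x = q⁻¹ - 1` is the positive root of `x ^ 2 = μ (1 + x)`.
  set r := Real.sqrt (μ ^ 2 + 4 * μ) with hr
  have hr2 : r ^ 2 = μ ^ 2 + 4 * μ := Real.sq_sqrt (by positivity)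
  have hr0 : 0 ≤ r := Real.sqrt_nonneg _
  set x := (μ + r) / 2 with hx
  have hx0 : 0 < x := by positivity
  have hx2 : x ^ 2 = μ * (1 + x) := by
    rw [hx]; nlinarith
  have hrle : r ≤ μ + 2 * Real.sqrt μ := by
    rw [hr]
    refine Real.sqrt_le_iff.mpr ⟨by positivity, ?_⟩
    nlinarith [Real.sq_sqrt hμ0.le, Real.sqrt_nonneg μ]
  have hxle : x ≤ μ + Real.sqrt μ := by rw [hx]; linarith
  refine ⟨(1 + x)⁻¹, by positivity, inv_lt_one_of_one_lt₀ (by linarith), ?_, ?_⟩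
  · field_simp
    rw [add_sub_cancel_left, hx2]
    linear_combination (1 + x) * hμα
  · have hsκ : 1 ≤ Real.sqrt κ := Real.one_le_sqrt.mpr hκ1.le
    have hlog : -Real.log (1 + x)⁻¹ ≤ x := by
      rw [Real.log_inv, neg_neg]
      linarith [Real.log_le_sub_one_of_pos (by linarith : 0 < 1 + x)]
    have h1 : Real.sqrt κ * Real.sqrt μ ≤ Real.sqrt K := by
      rw [← Real.sqrt_mul (by linarith)]
      exact Real.sqrt_le_sqrt hμκ
    have h2 : Real.sqrt κ * μ ≤ K := by
      refine le_trans ?_ hμκ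
      gcongr
      rw [Real.sqrt_le_left (by linarith)]
      nlinarith
    calc Real.sqrt κ * -Real.log (1 + x)⁻¹ ≤ Real.sqrt κ * (μ + Real.sqrt μ) := by
          gcongr; linarith
      _ = Real.sqrt κ * μ + Real.sqrt κ * Real.sqrt μ := mul_add _ _ _
      _ ≤ _ := add_le_add h2 h1

end LowerBound

end

theorem corollary2 :
    ∀ κ₀ : ℝ, 1 < κ₀ → ∃ C : ℝ, 0 < C ∧
      ∀ α β γ : ℝ, 0 < α → κ₀ ≤ β / α → 0 < γ → γ ≤ 1 →
        ∃ (n : ℕ) (hn : 2 ≤ n) (G : SimpleGraph (Fin n)) (W : Matrix (Fin n) (Fin n) ℝ)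
          (hW : IsGossipMatrix G W) (f : Fin n → lp (fun _ : ℕ => ℝ) 2 → ℝ)
          (θopt : lp (fun _ : ℕ => ℝ) 2),
          G.Connected ∧
          eigengap hn hW.posSemidef.isHermitian = γ ∧
          (∀ i, StrongConvexOn Set.univ α (f i)) ∧
          (∀ i, IsSmoothFun β (f i)) ∧
          (∀ θ, averageFun f θopt ≤ averageFun f θ) ∧
          ∀ τ : ℝ, 0 < τ → ∀ P : BlackBoxProcedure W τ f,
            ∀ ε : ℝ, 0 < ε → ∀ t : ℝ, 0 ≤ t → ∀ i : Fin n,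
              averageFun f (P.output i t) - averageFun f θopt ≤ ε →
              C * (Real.sqrt (β / α) * (1 + τ / Real.sqrt γ) * Real.log (1 / ε)) ≤ t := by
  intro κ₀ hκ₀
  set R := 6 * κ₀ / (κ₀ - 1) + Real.sqrt (6 * κ₀ / (κ₀ - 1)) with hR
  have hR0 : 0 < R :=
    add_pos_of_pos_of_nonneg (div_pos (by linarith) (by linarith)) (Real.sqrt_nonneg _)
  refine ⟨1 / (48 * R), by positivity, fun α β γ hα hκ hγ hγ1 => ?_⟩
  obtain ⟨m, hm, W, hW, hgap, hmγ⟩ := exists_isGossipMatrix hγ hγ1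
  obtain ⟨q, hq0, hq1, hq, hqR⟩ := exists_ratio hκ₀ hα hκ
  rw [← hR] at hqR
  have hαβ : α ≤ β := by
    have := hκ₀.trans_le hκ
    rw [lt_div_iff₀ hα] at this
    linarith
  -- The scale of the minimizer is free; this one absorbs the rounding of the number of rounds.
  set a := Real.sqrt (2 / (α * q ^ 6)) with ha
  have ha2 : α / 2 * a ^ 2 * q ^ 6 = 1 := by
    rw [ha, Real.sq_sqrt (by positivity)]
    field_simp
  set θ := geomL2 a q hq0.le hq1 with hθ
  set b : lp (fun _ : ℕ => ℝ) 2 := lp.single 2 0 (((5 * α + β) * a - (β - α) * (a * q)) / 6)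
    with hb
  have hb1 : b ∈ coordsBelow 1 := fun j hj => by
    rw [hb, lp.coeFn_single, Pi.single_eq_of_ne (by omega)]
  have hinv : ∀ i : Fin (3 * m), ∀ x, reindexL2 (nodeSwap m i) (reindexL2 (nodeSwap m i) x) = x :=
    fun i => reindexL2_reindexL2 (nodeSwap_nodeSwap m i)
  have hsymm : ∀ i : Fin (3 * m), ∀ x y, inner ℝ (reindexL2 (nodeSwap m i) x) y
      = inner ℝ x (reindexL2 (nodeSwap m i) y) :=
    fun i => inner_reindexL2_left (nodeSwap_nodeSwap m i)
  have hgrowth : ∀ x, α / 2 * ‖x - θ‖ ^ 2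
      ≤ averageFun (nodeFun m α β b) x - averageFun (nodeFun m α β b) θ :=
    le_averageFun_sub (by omega) (fun i => inner_twoEigMap_left (hsymm i) α β)
      (fun i => le_inner_twoEigMap_self (hinv i) (hsymm i) hαβ)
      (sum_twoEigMap_geomL2_sub hq0.le hq1 hq m)
  refine ⟨3 * m, by omega, squaredPath (3 * m), W, hW, nodeFun m α β b, θ,
    connected_squaredPath (by omega), hgap,
    fun i => strongConvexOn_quadFun_twoEigMap (hinv i) (hsymm i) hαβ b,
    fun i => isSmoothFun_quadFun_twoEigMap (hinv i) (hsymm i) hα hαβ b,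
    fun x => ?_, fun τ hτ P ε hε t ht i herr => ?_⟩
  · have := hgrowth x
    have h0 : 0 ≤ α / 2 * ‖x - θ‖ ^ 2 := by positivity
    linarith
  set round : ℝ := 1 + m / 2 * τ with hround
  have hround0 : 0 < round := by positivity
  set N := ⌊t / round⌋₊ with hN
  have hNle : N * round ≤ t := by
    have := Nat.floor_le (by positivity : 0 ≤ t / round)
    rwa [le_div_iff₀ hround0] at this
  have hNlt : t < (N + 1) * round := by
    have := Nat.lt_floor_add_one (t / round)
    rwa [div_lt_iff₀ hround0] at this
  have hmem : P.output i t ∈ coordsBelow (N + 3) := by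
    refine memory_subset_coordsBelow hW hα hαβ hb1 hτ P (by omega) ht i ?_ (P.output_mem i t ht)
    have h := mul_le_mul_of_nonneg_left (neg_le_hopBound (k := N + 3) i.2) hτ.le
    push_cast
    rw [← hround]
    nlinarith
  have hqε : q ^ (2 * N) ≤ ε := by
    calc q ^ (2 * N) = α / 2 * a ^ 2 * q ^ 6 * q ^ (2 * N) := by rw [ha2, one_mul]
      _ = α / 2 * (a * q ^ (N + 3)) ^ 2 := by ring
      _ ≤ α / 2 * ‖P.output i t - θ‖ ^ 2 := by
        exact mul_le_mul_of_nonneg_left (sq_le_norm_sub_geomL2_sq hq0.le hq1 hmem) (by positivity)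
      _ ≤ ε := (hgrowth _).trans herr
  have hlog : Real.log (1 / ε) ≤ 2 * N * -Real.log q := by
    have h := Real.log_le_log (by positivity) hqε
    rw [Real.log_pow] at h
    push_cast at h
    rw [one_div, Real.log_inv]
    linarith
  have hlogq : 0 ≤ -Real.log q := by linarith [Real.log_nonpos hq0.le hq1.le]
  have hsize : 1 + τ / Real.sqrt γ ≤ 24 * round := by
    have h := mul_le_mul_of_nonneg_left hmγ hτ.le
    rw [mul_one_div] at h
    rw [hround]
    nlinarith
  have hfac : 0 ≤ Real.sqrt (β / α) * (1 + τ / Real.sqrt γ) := by positivity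
  calc 1 / (48 * R) * (Real.sqrt (β / α) * (1 + τ / Real.sqrt γ) * Real.log (1 / ε))
      ≤ 1 / (48 * R) * (Real.sqrt (β / α) * (1 + τ / Real.sqrt γ) * (2 * N * -Real.log q)) := by
        gcongr
    _ ≤ 1 / (48 * R) * (Real.sqrt (β / α) * (24 * round) * (2 * N * -Real.log q)) := by
        gcongr
    _ = 1 / R * (N * round) * (Real.sqrt (β / α) * -Real.log q) := by
        field_simp
        ring
    _ ≤ 1 / R * (N * round) * R := by gcongr
    _ = N * round := by field_simp
    _ ≤ t := hNle
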